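/- Consider $[0,1)$ with Lebesgue measure. A filtration is a sequence $\mathcal A_1,\mathcal A_2,\dots$ of countable partitions of $[0,1)$ into Lebesgue measurable sets such that every $A\in\mathcal A_n$ is a union of some sets of $\mathcal A_{n+1}$. A martingale difference is a sequence of real functions $f_n\in L^1(0,1)$, $n\ge 1$, for which there is a filtration $\{\mathcal A_n\}$ such that $f_n$ is constant on each $A\in\mathcal A_n$, and $\int_A f_n=0$ for every $A\in\mathcal A_{n-1}$, $n\ge 2$. Let $\{f_n\}$ be a martingale difference and let $p_n=\sum_{j\in G_n}c_jf_j$, $n=1,2,\dots$, where the $G_n\subset\mathbb N$ are finite and pairwise disjoint, $c_j\in\mathbb R$, and $\|p_n\|_{L^2(0,1)}=1$ for all $n$. Let $\omega(1)\le\omega(2)\le\cdots$ be positive numbers such that $\omega(n)/\log_2 n$, $n\ge 2$, is nondecreasing and $$\sum_{n=1}^\infty\frac{1}{n\,\omega(n)}<\infty .$$ Then $\omega(n)$ is an a.e. unconditional convergence Weyl multiplier for $\{p_n\}$. That is: $\{p_n\}$ is an orthonormal system, $\omega(n)$ is positive and nondecreasing with $\omega(n)\to\infty$, and for all real numbers $a_n$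 with $\sum_{n=1}^\infty a_n^2\,\omega(n)<\infty$ and every permutation $\sigma$ of $\{1,2,\dots\}$ the series $\sum_{n=1}^\infty a_{\sigma(n)}p_{\sigma(n)}(x)$ converges for almost every $x\in[0,1)$. -/

import Mathlib

open MeasureTheory Filter Topology

namespace WeylMultipliers

/-! Sequences `x₁, x₂, …` are indexed by `ℕ`, the entry with index `n` being `xₙ₊₁`. -/

/-- Lebesgue measure on `[0,1)`. -/
noncomputable def unitMeasure : Measure ℝ := volume.restrict (Set.Ico (0 : ℝ) 1)

/-- A partition of `[0,1)` into (finitely or countably many, pairwise disjoint)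
Lebesgue measurable sets. -/
structure IsPartition (P : Set (Set ℝ)) : Prop where
  countable : P.Countable
  measurable : ∀ A ∈ P, NullMeasurableSet A volume
  disjoint : P.PairwiseDisjoint id
  sUnion_eq : ⋃₀ P = Set.Ico (0 : ℝ) 1

/-- A filtration: a sequence of partitions of `[0,1)` such that every element of a partition
is a union of some elements of the next one. -/
structure IsPartitionFiltration (𝒜 : ℕ → Set (Set ℝ)) : Prop where
  partition : ∀ n, IsPartition (𝒜 n)
  refine_succ : ∀ n, ∀ A ∈ 𝒜 n, ∃ S ⊆ 𝒜 (n + 1), A = ⋃₀ S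

/-- `f` is a martingale difference based on the filtration `𝒜`. -/
structure IsMartingaleDifferenceOn (𝒜 : ℕ → Set (Set ℝ)) (f : ℕ → ℝ → ℝ) : Prop where
  filtration : IsPartitionFiltration 𝒜
  integrable : ∀ n, Integrable (f n) unitMeasure
  constant_on : ∀ n, ∀ A ∈ 𝒜 n, ∃ c : ℝ, ∀ x ∈ A, f n x = c
  integral_eq_zero : ∀ n, ∀ A ∈ 𝒜 n, ∫ x in A, f (n + 1) x = 0

/-- `f` is a martingale difference, i.e. it is based on some filtration of `[0,1)`. -/
def IsMartingaleDifference (f : ℕ → ℝ → ℝ) : Prop :=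
  ∃ 𝒜 : ℕ → Set (Set ℝ), IsMartingaleDifferenceOn 𝒜 f

/-- `p` is a sequence of non-overlapping `f`-polynomials: `pₙ = ∑_{j ∈ Gₙ} cⱼ fⱼ` on `[0,1)`
with finite pairwise disjoint sets of indices `Gₙ`. -/
def IsNonOverlappingPolynomials (f p : ℕ → ℝ → ℝ) : Prop :=
  ∃ (G : ℕ → Finset ℕ) (c : ℕ → ℝ),
    (∀ m n, m ≠ n → Disjoint (G m) (G n)) ∧
    ∀ n, ∀ x ∈ Set.Ico (0 : ℝ) 1, p n x = ∑ j ∈ G n, c j * f j x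

/-- An orthonormal system in `L²(0,1)`. -/
structure IsOrthonormalSystem (φ : ℕ → ℝ → ℝ) : Prop where
  memLp : ∀ n, MemLp (φ n) 2 unitMeasure
  norm_eq_one : ∀ n, ∫ x, φ n x * φ n x ∂unitMeasure = 1
  orthogonal : ∀ m n, m ≠ n → ∫ x, φ m x * φ n x ∂unitMeasure = 0

/-- The series `∑ gₙ(x)` converges (to a finite limit) for a.e. `x ∈ [0,1)`. -/
def AEConvergent (g : ℕ → ℝ → ℝ) : Prop :=
  ∀ᵐ x ∂unitMeasure, ∃ l : ℝ,
    Tendsto (fun N : ℕ => ∑ n ∈ Finset.range N, g n x) atTop (𝓝 l)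

/-- The series `∑ gₙ(x)` converges unconditionally a.e.: every rearrangement of it converges
almost everywhere (the exceptional null set may depend on the rearrangement). -/
def AEUnconditionallyConvergent (g : ℕ → ℝ → ℝ) : Prop :=
  ∀ σ : Equiv.Perm ℕ, AEConvergent (fun n => g (σ n))

/-- `ω` is an a.e. unconditional convergence Weyl multiplier for the orthonormal system `φ`. -/
structure IsUCMultiplier (ω : ℕ → ℝ) (φ : ℕ → ℝ → ℝ) : Prop where
  orthonormal : IsOrthonormalSystem φ
  pos : ∀ n, 0 < ω n
  mono : Monotone ω
  tendsto : Tendsto ω atTop atTop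
  convergent : ∀ a : ℕ → ℝ, Summable (fun n => a n ^ 2 * ω n) →
    AEUnconditionallyConvergent (fun n x => a n * φ n x)

end WeylMultipliers

namespace WeylMultipliers

/-! The mechanism is a self-normalized exponential inequality, insensitive to the order of
summation. Put D_j = c_j f_j, so that p_n is the sum of D_j over G_n, and Q_n = ∑_{j ∈ G_n} (D_j² +
2 E[D_j² | 𝒜_{j-1}]), without the conditional term for the first index. Since exp(x - x²) ≤ 1 + x +
2x², the exponential of a finite sum of scaled increments, compensated by these brackets, is a
supermartingale without any boundedness of D_j (`integral_compensatedExp_le`). Hence, for every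
finite E, |∑_{n ∈ E} a_n p_n| ≥ u/t + t ∑_{n ∈ E} a_n² Q_n has probability at most 4e^{-u}.

Split the indices into blocks 2^{2^k} ≤ n < 2^{2^{k+1}}. A rearrangement visits each block through
at most as many nonempty initial segments as the block has elements, fewer than e^{2·2^k}. With u =
3·2^k and t = ω(2^{2^k}), a union bound and Borel–Cantelli (`ae_eventually_block_bound`) bound a.e.
all these partial sums, for large k, by 3·2^k/ω(2^{2^k}) + ω(2^{2^k}) ∑_{n in block} a_n² Q_n. The
first term is summable by condensing ∑ 1/(n ω(n)) twice; the second is a.e. summable because Q_n has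
integral at most 3 and ∑ a_n² ω(n) < ∞. Summable bounds on blocks give convergence of the rearranged
series (`exists_tendsto_sum_of_block_bound`). -/

instance : IsProbabilityMeasure unitMeasure :=
  ⟨by simp [unitMeasure]⟩

/-- `g` is constant on every element of `P`. -/
def ConstOnAtoms (P : Set (Set ℝ)) (g : ℝ → ℝ) : Prop :=
  ∀ A ∈ P, ∀ x ∈ A, ∀ y ∈ A, g x = g y

/-- The conditional expectation of `g` with respect to the partition `P`. -/
noncomputable def atomAverage (P : Set (Set ℝ)) (g : ℝ → ℝ) (x : ℝ) : ℝ :=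
  ⨍ y in {y | ∃ A ∈ P, x ∈ A ∧ y ∈ A}, g y ∂unitMeasure

/-! ### Conditional expectation with respect to a countable partition -/

namespace IsPartition

variable {P : Set (Set ℝ)} {Y g : ℝ → ℝ}

lemma subset (hP : IsPartition P) {A : Set ℝ} (hA : A ∈ P) : A ⊆ Set.Ico (0 : ℝ) 1 :=
  hP.sUnion_eq ▸ Set.subset_sUnion_of_mem hA

lemma nullMeasurableSet (hP : IsPartition P) {A : Set ℝ} (hA : A ∈ P) :
    NullMeasurableSet A unitMeasure :=
  (hP.measurable A hA).mono_ac Measure.absolutelyContinuous_restrict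

lemma restrict_eq (hP : IsPartition P) {A : Set ℝ} (hA : A ∈ P) :
    unitMeasure.restrict A = volume.restrict A :=
  Measure.restrict_restrict_of_subset (hP.subset hA)

lemma restrict_iUnion (hP : IsPartition P) :
    unitMeasure.restrict (⋃ A : P, (A : Set ℝ)) = unitMeasure := by
  rw [← Set.sUnion_eq_iUnion, hP.sUnion_eq, unitMeasure, Measure.restrict_restrict_of_subset le_rfl]

lemma pairwise_aedisjoint (hP : IsPartition P) :
    Pairwise (Function.onFun (AEDisjoint unitMeasure) fun A : P => (A : Set ℝ)) :=
  fun A B hAB => (hP.disjoint A.2 B.2 fun h => hAB (Subtype.ext h)).aedisjoint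

lemma hasSum_integral (hP : IsPartition P) (hg : Integrable g unitMeasure) :
    HasSum (fun A : P => ∫ x in (A : Set ℝ), g x ∂unitMeasure) (∫ x, g x ∂unitMeasure) := by
  have := hP.countable.to_subtype
  have h := hasSum_integral_iUnion_ae (μ := unitMeasure) (f := g) (s := fun A : P => (A : Set ℝ))
    (fun A => hP.nullMeasurableSet A.2) hP.pairwise_aedisjoint hg.integrableOn
  rwa [hP.restrict_iUnion] at h

lemma aestronglyMeasurable (hP : IsPartition P) (hY : ConstOnAtoms P Y) :
    AEStronglyMeasurable Y unitMeasure := by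
  have := hP.countable.to_subtype
  rw [← hP.restrict_iUnion]
  refine AEStronglyMeasurable.iUnion fun A => ?_
  obtain h | ⟨a, ha⟩ := (A : Set ℝ).eq_empty_or_nonempty
  · simp [h]
  · refine (aestronglyMeasurable_const (b := Y a)).congr ?_
    filter_upwards [ae_restrict_mem₀ (hP.nullMeasurableSet A.2)] with x hx using hY A A.2 a ha x hx

/-- A function with vanishing integrals over the elements of a partition is orthogonal to the
functions constant on these elements. -/
lemma integral_mul_eq_zero (hP : IsPartition P) (hY : ConstOnAtoms P Y)
    (hYg : Integrable (fun x => Y x * g x) unitMeasure)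
    (hg : ∀ A ∈ P, ∫ x in A, g x ∂unitMeasure = 0) :
    ∫ x, Y x * g x ∂unitMeasure = 0 := by
  rw [← (hP.hasSum_integral hYg).tsum_eq]
  refine (tsum_congr fun ⟨A, hA⟩ => ?_).trans tsum_zero
  obtain rfl | ⟨a, ha⟩ := A.eq_empty_or_nonempty
  · simp
  · rw [setIntegral_congr_fun₀ (g := fun x => Y a * g x) (hP.nullMeasurableSet hA)
      fun x hx => by simp only [hY A hA x hx a ha], integral_const_mul, hg A hA, mul_zero]

lemma atomAverage_eq (hP : IsPartition P) {A : Set ℝ} (hA : A ∈ P) {x : ℝ} (hx : x ∈ A) :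
    atomAverage P g x = ⨍ y in A, g y ∂unitMeasure := by
  have : {y | ∃ B ∈ P, x ∈ B ∧ y ∈ B} = A := by
    ext y
    constructor
    · rintro ⟨B, hB, hxB, hy⟩
      rwa [hP.disjoint.elim_set hA hB x hx hxB]
    · exact fun hy => ⟨A, hA, hx, hy⟩
  rw [atomAverage, this]

lemma constOnAtoms_atomAverage (hP : IsPartition P) : ConstOnAtoms P (atomAverage P g) :=
  fun A hA x hx y hy => by rw [hP.atomAverage_eq hA hx, hP.atomAverage_eq hA hy]

lemma setIntegral_atomAverage (hP : IsPartition P) {A : Set ℝ} (hA : A ∈ P) :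
    ∫ x in A, atomAverage P g x ∂unitMeasure = ∫ x in A, g x ∂unitMeasure := by
  rw [setIntegral_congr_fun₀ (hP.nullMeasurableSet hA) fun x hx => hP.atomAverage_eq hA hx,
    setIntegral_const, measure_smul_setAverage _ (measure_ne_top _ _)]

lemma integrableOn_of_constOnAtoms (hP : IsPartition P) (hY : ConstOnAtoms P Y) {A : Set ℝ}
    (hA : A ∈ P) : IntegrableOn Y A unitMeasure := by
  obtain h | ⟨a, ha⟩ := A.eq_empty_or_nonempty
  · simp [h]
  · refine (integrable_const (Y a)).congr ?_
    filter_upwards [ae_restrict_mem₀ (hP.nullMeasurableSet hA)] with x hx using hY A hA a ha x hx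

lemma integrable_of_summable (hP : IsPartition P) (hY : ConstOnAtoms P Y) (hY0 : ∀ x, 0 ≤ Y x)
    (hsum : Summable fun A : P => ∫ x in (A : Set ℝ), Y x ∂unitMeasure) :
    Integrable Y unitMeasure := by
  have := hP.countable.to_subtype
  have h := integrableOn_iUnion_of_summable_integral_norm (μ := unitMeasure) (f := Y)
    (s := fun A : P => (A : Set ℝ)) (fun A => hP.integrableOn_of_constOnAtoms hY A.2)
    (by simpa only [Real.norm_of_nonneg (hY0 _)] using hsum)
  rwa [IntegrableOn, hP.restrict_iUnion] at h

lemma atomAverage_nonneg (hg : ∀ x, 0 ≤ g x) (x : ℝ) : 0 ≤ atomAverage P g x := by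
  rw [atomAverage, setAverage_eq]
  exact smul_nonneg (by positivity) (integral_nonneg hg)

lemma integrable_atomAverage (hP : IsPartition P) (hg : Integrable g unitMeasure)
    (hg0 : ∀ x, 0 ≤ g x) : Integrable (atomAverage P g) unitMeasure := by
  refine hP.integrable_of_summable hP.constOnAtoms_atomAverage (atomAverage_nonneg hg0) ?_
  simpa only [hP.setIntegral_atomAverage (Subtype.prop _)] using (hP.hasSum_integral hg).summable

lemma integral_atomAverage (hP : IsPartition P) (hg : Integrable g unitMeasure)
    (hg0 : ∀ x, 0 ≤ g x) : ∫ x, atomAverage P g x ∂unitMeasure = ∫ x, g x ∂unitMeasure := by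
  rw [← (hP.hasSum_integral hg).tsum_eq,
    ← (hP.hasSum_integral (hP.integrable_atomAverage hg hg0)).tsum_eq]
  exact tsum_congr fun A => hP.setIntegral_atomAverage A.2

lemma integral_mul_atomAverage (hP : IsPartition P) (hY : ConstOnAtoms P Y)
    (hg : Integrable g unitMeasure) (hg0 : ∀ x, 0 ≤ g x)
    (hYg : Integrable (fun x => Y x * g x) unitMeasure)
    (hYs : Integrable (fun x => Y x * atomAverage P g x) unitMeasure) :
    ∫ x, Y x * g x ∂unitMeasure = ∫ x, Y x * atomAverage P g x ∂unitMeasure := by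
  rw [← sub_eq_zero, ← integral_sub hYg hYs]
  simp only [← mul_sub]
  refine hP.integral_mul_eq_zero hY ((hYg.sub hYs).congr (.of_forall fun x => by simp [mul_sub])) fun A hA => ?_
  rw [integral_sub hg.integrableOn (hP.integrable_atomAverage hg hg0).integrableOn,
    hP.setIntegral_atomAverage hA, sub_self]

/-- If `h` is constant on the elements of `P` and is the conditional expectation of a square
integrable function, then `h` is square integrable. -/
lemma memLp_two_of_setIntegral_eq (hP : IsPartition P) (hY : ConstOnAtoms P Y)
    (hg : MemLp g 2 unitMeasure)
    (h : ∀ A ∈ P, ∫ x in A, g x ∂unitMeasure = ∫ x in A, Y x ∂unitMeasure) :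
    MemLp Y 2 unitMeasure := by
  rw [memLp_two_iff_integrable_sq (hP.aestronglyMeasurable hY)]
  have hY2 : ConstOnAtoms P fun x => Y x ^ 2 := fun A hA x hx y hy => by simp only [hY A hA x hx y hy]
  refine hP.integrable_of_summable hY2 (fun x => sq_nonneg _) ?_
  refine (hP.hasSum_integral hg.integrable_sq).summable.of_nonneg_of_le
    (fun A => integral_nonneg fun x => sq_nonneg _) fun ⟨A, hA⟩ => ?_
  obtain rfl | ⟨a, ha⟩ := A.eq_empty_or_nonempty
  · simp
  have hYa : ∀ x ∈ A, Y x = Y a := fun x hx => hY A hA x hx a ha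
  have hm := hP.nullMeasurableSet hA
  have hg1 : Integrable g (unitMeasure.restrict A) := (hg.integrable one_le_two).integrableOn
  -- Jensen's inequality on one atom, by the tangent line to the square at the constant value `Y a`.
  have key : ∫ x in A, (2 * Y a * g x - Y a ^ 2) ∂unitMeasure ≤ ∫ x in A, g x ^ 2 ∂unitMeasure :=
    integral_mono ((hg1.const_mul _).sub (integrable_const _)) hg.integrable_sq.integrableOn
      fun x => by nlinarith [sq_nonneg (g x - Y a)]
  rw [integral_sub (hg1.const_mul _) (integrable_const _), integral_const_mul, h A hA,
    setIntegral_congr_fun₀ hm hYa, setIntegral_const, setIntegral_const] at key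
  change ∫ x in A, Y x ^ 2 ∂unitMeasure ≤ _
  rw [setIntegral_congr_fun₀ (g := fun _ => Y a ^ 2) hm (fun x hx => by simp only [hYa x hx]),
    setIntegral_const]
  simp only [smul_eq_mul] at key ⊢
  linarith

end IsPartition

/-! ### The exponential supermartingale and the self-normalized Chernoff bound -/

/-- The term -x² tames large x, so the bound holds on the whole line. For |x| ≤ 1/2 use e^y ≤ 1 + y
+ y² with y = x - x², where y² ≤ 3x²; outside, y ≤ -3/4 on the left and y ≤ 1/4 on the right
suffice. -/
lemma exp_sub_sq_le (x : ℝ) : Real.exp (x - x ^ 2) ≤ 1 + x + 2 * x ^ 2 := by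
  obtain h | h := le_total |x| (1 / 2)
  · obtain ⟨h1, h2⟩ := abs_le.1 h
    have h3 : |x - x ^ 2| ≤ 1 := abs_le.2 ⟨by nlinarith, by nlinarith⟩
    have h4 := (abs_le.1 (Real.abs_exp_sub_one_sub_id_le h3)).2
    nlinarith [mul_nonneg (sq_nonneg x) (by nlinarith : 0 ≤ 3 - (1 - x) ^ 2)]
  · obtain h | h := le_abs'.1 h
    · have h4 := (abs_le.1 (Real.abs_exp_sub_one_sub_id_le (x := -3 / 4) (by norm_num [abs_le]))).2
      have h5 : Real.exp (x - x ^ 2) ≤ Real.exp (-3 / 4) := Real.exp_le_exp.2 (by nlinarith)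
      nlinarith [sq_nonneg (x + 1 / 4)]
    · have h4 := (abs_le.1 (Real.abs_exp_sub_one_sub_id_le (x := 1 / 4) (by norm_num [abs_le]))).2
      have h5 : Real.exp (x - x ^ 2) ≤ Real.exp (1 / 4) :=
        Real.exp_le_exp.2 (by nlinarith [sq_nonneg (x - 1 / 2)])
      nlinarith [sq_nonneg x]


lemma ConstOnAtoms.of_le {𝒜 : ℕ → Set (Set ℝ)} (h𝒜 : IsPartitionFiltration 𝒜) {g : ℝ → ℝ}
    {m n : ℕ} (hmn : m ≤ n) (hg : ConstOnAtoms (𝒜 m) g) : ConstOnAtoms (𝒜 n) g := by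
  induction n, hmn using Nat.le_induction with
  | base => exact hg
  | succ n _ ih =>
    intro A hA x hx y hy
    have hx1 := (h𝒜.partition (n + 1)).subset hA hx
    rw [← (h𝒜.partition n).sUnion_eq] at hx1
    obtain ⟨B, hB, hxB⟩ := hx1
    refine ih B hB x hxB y ?_
    obtain ⟨S, hS, rfl⟩ := h𝒜.refine_succ n B hB
    obtain ⟨A', hA', hxA'⟩ := hxB
    obtain rfl := (h𝒜.partition (n + 1)).disjoint.elim_set hA (hS hA') x hx hxA'
    exact ⟨A, hA', hy⟩

/-- `D` is a square integrable martingale difference based on the filtration `𝒜`. -/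
structure IsL2MartingaleDifferenceOn (𝒜 : ℕ → Set (Set ℝ)) (D : ℕ → ℝ → ℝ) : Prop where
  filtration : IsPartitionFiltration 𝒜
  memLp : ∀ n, MemLp (D n) 2 unitMeasure
  constOnAtoms : ∀ n, ConstOnAtoms (𝒜 n) (D n)
  setIntegral_eq_zero : ∀ n, ∀ A ∈ 𝒜 n, ∫ x in A, D (n + 1) x ∂unitMeasure = 0

/-- The increments of the sum of the square function of a martingale and twice its conditional
square function. -/
noncomputable def bracket (𝒜 : ℕ → Set (Set ℝ)) (D : ℕ → ℝ → ℝ) : ℕ → ℝ → ℝ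
  | 0, x => D 0 x ^ 2
  | n + 1, x => D (n + 1) x ^ 2 + 2 * atomAverage (𝒜 n) (fun y => D (n + 1) y ^ 2) x

lemma sq_le_bracket (𝒜 : ℕ → Set (Set ℝ)) (D : ℕ → ℝ → ℝ) (n : ℕ) (x : ℝ) :
    D n x ^ 2 ≤ bracket 𝒜 D n x := by
  cases n with
  | zero => exact le_rfl
  | succ n =>
    have := IsPartition.atomAverage_nonneg (P := 𝒜 n) (fun y => sq_nonneg (D (n + 1) y)) x
    simp only [bracket]
    linarith

lemma bracket_nonneg (𝒜 : ℕ → Set (Set ℝ)) (D : ℕ → ℝ → ℝ) (n : ℕ) (x : ℝ) :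
    0 ≤ bracket 𝒜 D n x :=
  (sq_nonneg _).trans (sq_le_bracket 𝒜 D n x)

/-- The exponential of a sum of scaled increments, compensated by the bracket. -/
noncomputable def compensatedExp (𝒜 : ℕ → Set (Set ℝ)) (D : ℕ → ℝ → ℝ) (r : ℕ → ℝ) (J : Finset ℕ)
    (x : ℝ) : ℝ :=
  Real.exp (∑ j ∈ J, (r j * D j x - r j ^ 2 * bracket 𝒜 D j x))

/-- Each exponent is at most y - y² ≤ 1/4 with y = r_j D_j. This boundedness gives integrability
although D is only square integrable. -/
lemma compensatedExp_le (𝒜 : ℕ → Set (Set ℝ)) (D : ℕ → ℝ → ℝ) (r : ℕ → ℝ) (J : Finset ℕ) (x : ℝ) :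
    compensatedExp 𝒜 D r J x ≤ Real.exp (J.card • (1 / 4 : ℝ)) := by
  refine Real.exp_le_exp.2 (Finset.sum_le_card_nsmul _ _ _ fun j _ => ?_)
  nlinarith [mul_le_mul_of_nonneg_left (sq_le_bracket 𝒜 D j x) (sq_nonneg (r j)),
    sq_nonneg (r j * D j x - 1 / 2)]

namespace IsL2MartingaleDifferenceOn

variable {𝒜 : ℕ → Set (Set ℝ)} {D : ℕ → ℝ → ℝ}

lemma constOnAtoms_bracket (hD : IsL2MartingaleDifferenceOn 𝒜 D) (n : ℕ) :
    ConstOnAtoms (𝒜 n) (bracket 𝒜 D n) := by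
  intro A hA x hx y hy
  cases n with
  | zero => simp only [bracket, hD.constOnAtoms 0 A hA x hx y hy]
  | succ n =>
    simp only [bracket, hD.constOnAtoms _ A hA x hx y hy,
      ((hD.filtration.partition n).constOnAtoms_atomAverage.of_le hD.filtration n.le_succ) A hA
        x hx y hy]

lemma integrable_bracket (hD : IsL2MartingaleDifferenceOn 𝒜 D) (n : ℕ) :
    Integrable (bracket 𝒜 D n) unitMeasure := by
  cases n with
  | zero => exact (hD.memLp 0).integrable_sq
  | succ n =>
    exact (hD.memLp _).integrable_sq.add (((hD.filtration.partition n).integrable_atomAverage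
      (hD.memLp _).integrable_sq fun x => sq_nonneg _).const_mul 2)

lemma integral_bracket_le (hD : IsL2MartingaleDifferenceOn 𝒜 D) (n : ℕ) :
    ∫ x, bracket 𝒜 D n x ∂unitMeasure ≤ 3 * ∫ x, D n x ^ 2 ∂unitMeasure := by
  cases n with
  | zero =>
    simp only [bracket]
    have h : 0 ≤ ∫ x, D 0 x ^ 2 ∂unitMeasure := integral_nonneg fun x => sq_nonneg (D 0 x)
    linarith
  | succ n =>
    have h := (hD.memLp (n + 1)).integrable_sq
    have h0 : ∀ x, 0 ≤ D (n + 1) x ^ 2 := fun x => sq_nonneg _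
    have hP := hD.filtration.partition n
    simp only [bracket]
    rw [integral_add h ((hP.integrable_atomAverage h h0).const_mul 2), integral_const_mul,
      hP.integral_atomAverage h h0]
    linarith

lemma integral_mul_eq_zero_of_lt (hD : IsL2MartingaleDifferenceOn 𝒜 D) {i j : ℕ} (hij : i < j) :
    ∫ x, D i x * D j x ∂unitMeasure = 0 := by
  obtain ⟨n, rfl⟩ : ∃ n, j = n + 1 := ⟨j - 1, by omega⟩
  exact (hD.filtration.partition n).integral_mul_eq_zero
    ((hD.constOnAtoms i).of_le hD.filtration (by omega))
    ((hD.memLp i).integrable_mul (hD.memLp _)) (hD.setIntegral_eq_zero n)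

lemma constOnAtoms_compensatedExp (hD : IsL2MartingaleDifferenceOn 𝒜 D) (r : ℕ → ℝ)
    {J : Finset ℕ} {n : ℕ} (hJ : ∀ j ∈ J, j ≤ n) :
    ConstOnAtoms (𝒜 n) (compensatedExp 𝒜 D r J) := by
  intro A hA x hx y hy
  refine congrArg Real.exp (Finset.sum_congr rfl fun j hj => ?_)
  rw [(hD.constOnAtoms j).of_le hD.filtration (hJ j hj) A hA x hx y hy,
    (hD.constOnAtoms_bracket j).of_le hD.filtration (hJ j hj) A hA x hx y hy]

lemma aestronglyMeasurable_compensatedExp (hD : IsL2MartingaleDifferenceOn 𝒜 D) (r : ℕ → ℝ)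
    (J : Finset ℕ) : AEStronglyMeasurable (compensatedExp 𝒜 D r J) unitMeasure :=
  (hD.filtration.partition (J.sup id)).aestronglyMeasurable
    (hD.constOnAtoms_compensatedExp r fun _ hj => Finset.le_sup (f := id) hj)

lemma integrable_compensatedExp (hD : IsL2MartingaleDifferenceOn 𝒜 D) (r : ℕ → ℝ)
    (J : Finset ℕ) : Integrable (compensatedExp 𝒜 D r J) unitMeasure :=
  .of_bound (hD.aestronglyMeasurable_compensatedExp r J) (Real.exp (J.card • (1 / 4 : ℝ)))
    (.of_forall fun x => by
      rw [compensatedExp, Real.norm_of_nonneg (Real.exp_pos _).le]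
      exact compensatedExp_le 𝒜 D r J x)

/-- Conditionally on 𝒜_n, the new factor exp(ρD - ρ²D²) has mean at most 1 + 2ρ²s ≤ exp(2ρ²s), where
s is the conditional mean of D²; the conditional part of the bracket cancels exactly this. -/
lemma integral_compensatedExp_insert_le (hD : IsL2MartingaleDifferenceOn 𝒜 D) (r : ℕ → ℝ)
    {J : Finset ℕ} {n : ℕ} (hJ : ∀ j ∈ J, j ≤ n) :
    ∫ x, compensatedExp 𝒜 D r (insert (n + 1) J) x ∂unitMeasure ≤
      ∫ x, compensatedExp 𝒜 D r J x ∂unitMeasure := by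
  have hn : n + 1 ∉ J := fun h => by have := hJ _ h; omega
  have hP := hD.filtration.partition n
  have hsq := (hD.memLp (n + 1)).integrable_sq
  have hsq0 : ∀ x, 0 ≤ D (n + 1) x ^ 2 := fun x => sq_nonneg _
  set s := atomAverage (𝒜 n) fun y => D (n + 1) y ^ 2 with hs
  have hs0 : ∀ x, 0 ≤ s x := IsPartition.atomAverage_nonneg hsq0
  have hsint : Integrable s unitMeasure := hP.integrable_atomAverage hsq hsq0
  have hsconst : ConstOnAtoms (𝒜 n) s := hP.constOnAtoms_atomAverage
  set Z := compensatedExp 𝒜 D r J with hZ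
  have hZ0 : ∀ x, 0 ≤ Z x := fun x => (Real.exp_pos _).le
  set ρ := r (n + 1) with hρ
  -- The part of the new exponential already determined by 𝒜_n: it is bounded, and it is orthogonal
  -- to `D (n + 1)`.
  set Y : ℝ → ℝ := fun x => Z x * Real.exp (-(2 * ρ ^ 2 * s x)) with hY
  have hY0 : ∀ x, 0 ≤ Y x := fun x => mul_nonneg (hZ0 x) (Real.exp_pos _).le
  have hYconst : ConstOnAtoms (𝒜 n) Y := fun A hA x hx y hy => by
    simp only [hY, hsconst A hA x hx y hy, hD.constOnAtoms_compensatedExp r hJ A hA x hx y hy, hZ]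
  have hYm := hP.aestronglyMeasurable hYconst
  have hYZ : ∀ x, Y x ≤ Z x := fun x => mul_le_of_le_one_right (hZ0 x)
    (Real.exp_le_one_iff.2 (by have := hs0 x; simp only [Left.neg_nonpos_iff]; positivity))
  have hYb : ∀ x, ‖Y x‖ ≤ Real.exp (J.card • (1 / 4 : ℝ)) := fun x => by
    rw [Real.norm_of_nonneg (hY0 x)]
    exact (hYZ x).trans (compensatedExp_le 𝒜 D r J x)
  have hYint : Integrable Y unitMeasure := .of_bound hYm _ (.of_forall hYb)
  have hYmul : ∀ {g : ℝ → ℝ}, Integrable g unitMeasure →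
      Integrable (fun x => Y x * g x) unitMeasure := fun hg => hg.bdd_mul hYm (.of_forall hYb)
  have hYD := hYmul ((hD.memLp (n + 1)).integrable one_le_two)
  have hYsq := hYmul hsq
  have hYs := hYmul hsint
  have hZint := hD.integrable_compensatedExp r J
  calc ∫ x, compensatedExp 𝒜 D r (insert (n + 1) J) x ∂unitMeasure
      ≤ ∫ x, (Y x + ρ * (Y x * D (n + 1) x) + 2 * ρ ^ 2 * (Y x * D (n + 1) x ^ 2))
          ∂unitMeasure := by
        refine integral_mono (hD.integrable_compensatedExp r _)
          ((hYint.add (hYD.const_mul ρ)).add (hYsq.const_mul (2 * ρ ^ 2))) fun x => ?_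
        have h1 : compensatedExp 𝒜 D r (insert (n + 1) J) x =
            Y x * Real.exp (ρ * D (n + 1) x - (ρ * D (n + 1) x) ^ 2) := by
          simp only [hY, hZ, compensatedExp, ← Real.exp_add, Finset.sum_insert hn, bracket]
          congr 1
          rw [← hs, ← hρ]
          ring
        have h2 := mul_le_mul_of_nonneg_left (exp_sub_sq_le (ρ * D (n + 1) x)) (hY0 x)
        simp only [h1]
        linarith
    _ = ∫ x, (Y x + 2 * ρ ^ 2 * (Y x * s x)) ∂unitMeasure := by
        rw [integral_add (f := fun x => Y x + ρ * (Y x * D (n + 1) x))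
            (hYint.add (hYD.const_mul ρ)) (hYsq.const_mul _),
          integral_add hYint (hYD.const_mul ρ), integral_add hYint (hYs.const_mul _),
          integral_const_mul, integral_const_mul, integral_const_mul,
          hP.integral_mul_eq_zero hYconst hYD (hD.setIntegral_eq_zero n),
          hP.integral_mul_atomAverage hYconst hsq hsq0 hYsq hYs]
        ring
    _ ≤ ∫ x, Z x ∂unitMeasure := by
        refine integral_mono (hYint.add (hYs.const_mul _)) hZint fun x => ?_
        have h1 := Real.add_one_le_exp (2 * ρ ^ 2 * s x)
        calc Y x + 2 * ρ ^ 2 * (Y x * s x) = Y x * (2 * ρ ^ 2 * s x + 1) := by ring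
          _ ≤ Y x * Real.exp (2 * ρ ^ 2 * s x) := mul_le_mul_of_nonneg_left h1 (hY0 x)
          _ = Z x := by simp only [hY]; rw [mul_assoc, ← Real.exp_add]; simp

/-- The exponential supermartingale inequality. -/
lemma integral_compensatedExp_le (hD : IsL2MartingaleDifferenceOn 𝒜 D) (r : ℕ → ℝ)
    (J : Finset ℕ) : ∫ x, compensatedExp 𝒜 D r J x ∂unitMeasure ≤ 2 := by
  induction J using Finset.induction_on_max with
  | empty => simp [compensatedExp]
  | insert j J hJ ih =>
    cases j with
    -- The initial function need not have mean zero, so only the pointwise bound e^{1/4} ≤ 2 is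
    -- available; hence the constant 2 instead of 1.
    | zero =>
      have hJ0 : J = ∅ := Finset.eq_empty_of_forall_notMem fun j hj => absurd (hJ j hj) (by simp)
      subst hJ0
      refine (integral_mono (hD.integrable_compensatedExp r _) (integrable_const _)
        (compensatedExp_le 𝒜 D r _)).trans ?_
      have h := (abs_le.1 (Real.abs_exp_sub_one_sub_id_le (x := 1 / 4) (by norm_num [abs_le]))).2
      simp only [insert_empty_eq, Finset.card_singleton, one_smul, integral_const, probReal_univ,
        smul_eq_mul]
      linarith
    | succ n =>
      exact (hD.integral_compensatedExp_insert_le r fun j hj => Nat.lt_succ_iff.1 (hJ j hj)).trans ih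

/-- A Chernoff bound, self-normalized by the bracket. -/
lemma measureReal_le_exp_neg (hD : IsL2MartingaleDifferenceOn 𝒜 D) (r : ℕ → ℝ) (J : Finset ℕ)
    {t : ℝ} (ht : 0 < t) (u : ℝ) :
    unitMeasure.real {x | u / t + t * ∑ j ∈ J, r j ^ 2 * bracket 𝒜 D j x ≤ |∑ j ∈ J, r j * D j x|} ≤
      4 * Real.exp (-u) := by
  have key : ∀ ρ : ℕ → ℝ, unitMeasure.real {x | Real.exp u ≤ compensatedExp 𝒜 D ρ J x} ≤
      2 * Real.exp (-u) := fun ρ => by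
    have h := (mul_meas_ge_le_integral_of_nonneg (μ := unitMeasure)
      (.of_forall fun x => (Real.exp_pos _).le) (hD.integrable_compensatedExp ρ J)
      (Real.exp u)).trans (hD.integral_compensatedExp_le ρ J)
    rw [Real.exp_neg, ← div_eq_mul_inv, le_div_iff₀ (Real.exp_pos u), mul_comm]
    exact h
  -- After multiplication by t, the two signs of the sum correspond to the coefficients t r_j and -t
  -- r_j.
  have hsub : {x | u / t + t * ∑ j ∈ J, r j ^ 2 * bracket 𝒜 D j x ≤ |∑ j ∈ J, r j * D j x|} ⊆
      {x | Real.exp u ≤ compensatedExp 𝒜 D (fun j => t * r j) J x} ∪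
        {x | Real.exp u ≤ compensatedExp 𝒜 D (fun j => -t * r j) J x} := by
    intro x hx
    simp only [Set.mem_ofPred_eq, Set.mem_union, compensatedExp, Real.exp_le_exp,
      Finset.sum_sub_distrib, mul_assoc, mul_pow, ← Finset.mul_sum, neg_sq] at hx ⊢
    have hx' := mul_le_mul_of_nonneg_left hx ht.le
    rw [mul_add, mul_div_cancel₀ _ ht.ne'] at hx'
    obtain h | h := abs_choice (∑ j ∈ J, r j * D j x) <;> rw [h] at hx'
    · left; nlinarith
    · right; nlinarith
  calc _ ≤ _ := measureReal_mono hsub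
    _ ≤ _ := measureReal_union_le _ _
    _ ≤ 4 * Real.exp (-u) := by linarith [key fun j => t * r j, key fun j => -t * r j]

end IsL2MartingaleDifferenceOn


/-! ### Condensation of the weight, and summation by blocks -/

lemma summable_one_div_weight {ω : ℕ → ℝ} (hpos : ∀ n, 0 < ω n) (hmono : Monotone ω)
    (hsum : Summable fun n : ℕ => 1 / (((n : ℝ) + 1) * ω n)) :
    Summable fun k : ℕ => 1 / ω (2 ^ k) := by
  rw [← summable_condensed_iff_of_nonneg
    (fun n => one_div_nonneg.2 (mul_nonneg (by positivity) (hpos n).le))] at hsum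
  · refine (hsum.mul_left 2).of_nonneg_of_le (fun k => one_div_nonneg.2 (hpos _).le) fun k => ?_
    have h1 : (1 : ℝ) ≤ 2 ^ k := one_le_pow₀ one_le_two
    have h2 := hpos (2 ^ k)
    push_cast
    rw [← mul_assoc, mul_one_div, div_le_div_iff₀ h2 (by positivity)]
    nlinarith
  · intro m n _ hmn
    have h1 := hpos m
    have h2 := hmono hmn
    have h3 : (m : ℝ) ≤ n := by exact_mod_cast hmn
    exact one_div_le_one_div_of_le (by positivity) (by gcongr)

/-- A second Cauchy condensation, applied to ∑ 1/ω(2^k). It controls the deviation terms u/t of the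
Chernoff bounds. -/
lemma summable_two_pow_div_weight {ω : ℕ → ℝ} (hpos : ∀ n, 0 < ω n) (hmono : Monotone ω)
    (hsum : Summable fun n : ℕ => 1 / (((n : ℝ) + 1) * ω n)) :
    Summable fun k : ℕ => (2 : ℝ) ^ k / ω (2 ^ 2 ^ k) := by
  have h := summable_one_div_weight hpos hmono hsum
  rw [← summable_condensed_iff_of_nonneg (fun n => one_div_nonneg.2 (hpos _).le)] at h
  · simpa only [mul_one_div] using h
  · intro m n _ hmn
    exact one_div_le_one_div_of_le (hpos _) (hmono (Nat.pow_le_pow_right two_pos hmn))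

lemma tendsto_weight_atTop {ω : ℕ → ℝ} (hpos : ∀ n, 0 < ω n) (hmono : Monotone ω)
    (hsum : Summable fun n : ℕ => 1 / (((n : ℝ) + 1) * ω n)) : Tendsto ω atTop atTop := by
  refine tendsto_atTop_atTop.2 fun b => ?_
  have h := (summable_one_div_weight hpos hmono hsum).tendsto_atTop_zero.eventually
    (gt_mem_nhds (show (0 : ℝ) < 1 / (|b| + 1) by positivity))
  obtain ⟨k, hk⟩ := h.exists
  refine ⟨2 ^ k, fun n hn => ?_⟩
  have := (one_div_lt_one_div (hpos _) (by positivity)).1 hk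
  linarith [hmono hn, le_abs_self b]

/-- A criterion for the convergence of a rearrangement in terms of the partial sums of blocks. -/
lemma exists_tendsto_sum_of_block_bound (κ : ℕ → ℕ) (B : ℕ → Finset ℕ)
    (hB : ∀ k n, n ∈ B k ↔ κ n = k) (σ : Equiv.Perm ℕ) (y : ℕ → ℝ) {δ : ℕ → ℝ} (hδ : Summable δ)
    (h : ∀ᶠ k in atTop, ∀ M, |∑ n ∈ B k with σ.symm n < M, y n| ≤ δ k) :
    ∃ l, Tendsto (fun M => ∑ i ∈ Finset.range M, y (σ i)) atTop (𝓝 l) := by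
  obtain ⟨K, hK⟩ := eventually_atTop.1 h
  -- The finitely many blocks before the estimate takes effect are dominated by their absolute sums.
  let bound : ℕ → ℝ := fun k => if k < K then ∑ n ∈ B k, |y n| else δ k
  have hbound : Summable bound := hδ.congr_atTop <| by
    filter_upwards [eventually_ge_atTop K] with k hk
    simp [bound, not_lt.2 hk]
  -- Tannery's theorem over the blocks: each finite block is eventually exhausted by the
  -- rearrangement, and its partial sums are dominated uniformly in M.
  have key := tendsto_tsum_of_dominated_convergence (𝓕 := atTop)
    (f := fun M k => ∑ n ∈ B k with σ.symm n < M, y n) (g := fun k => ∑ n ∈ B k, y n) hbound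
    (fun k => by
      refine tendsto_const_nhds.congr' ?_
      filter_upwards [eventually_gt_atTop ((B k).sup σ.symm)] with M hM
      rw [Finset.filter_true_of_mem fun n hn => (Finset.le_sup hn).trans_lt hM])
    (.of_forall fun M k => by
      by_cases hk : k < K
      · simp only [bound, if_pos hk]
        exact (Finset.abs_sum_le_sum_abs _ _).trans
          (Finset.sum_le_sum_of_subset_of_nonneg (Finset.filter_subset _ _)
            fun _ _ _ => abs_nonneg _)
      · simp only [bound, if_neg hk]
        exact hK k (not_lt.1 hk) M)
  refine ⟨_, key.congr fun M => ?_⟩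
  set T := (Finset.range M).map σ.toEmbedding with hT
  have hmem : ∀ n, n ∈ T ↔ σ.symm n < M := fun n => by
    simp only [hT, Finset.mem_map_equiv, Finset.mem_range]
  have hfib : ∀ k, (T.filter fun n => κ n = k) = (B k).filter fun n => σ.symm n < M := fun k => by
    ext n
    simp only [Finset.mem_filter, hmem, hB, and_comm]
  rw [tsum_eq_sum (s := T.image κ)]
  · simp only [← hfib]
    rw [Finset.sum_fiberwise_of_maps_to fun n hn => Finset.mem_image_of_mem κ hn, hT,
      Finset.sum_map]
    rfl
  · intro k hk
    rw [← hfib, Finset.filter_false_of_mem, Finset.sum_empty]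
    exact fun n hn h => hk (h ▸ Finset.mem_image_of_mem κ hn)

lemma Summable.sum_block {κ : ℕ → ℕ} {B : ℕ → Finset ℕ} (hB : ∀ k n, n ∈ B k ↔ κ n = k)
    {g : ℕ → ℝ} (hg0 : ∀ n, 0 ≤ g n) (hg : Summable g) : Summable fun k => ∑ n ∈ B k, g n := by
  refine summable_of_sum_le (c := ∑' n, g n) (fun k => Finset.sum_nonneg fun n _ => hg0 n)
    fun s => ?_
  rw [← Finset.sum_biUnion]
  · exact hg.sum_le_tsum _ fun n _ => hg0 n
  · intro k _ l _ hkl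
    exact Finset.disjoint_left.2 fun n hn hn' => hkl (((hB k n).1 hn).symm.trans ((hB l n).1 hn'))

/-! ### Reduction to blocks of a square integrable martingale difference -/

namespace IsMartingaleDifferenceOn

variable {𝒜 : ℕ → Set (Set ℝ)} {f : ℕ → ℝ → ℝ}

lemma constOnAtoms (hf : IsMartingaleDifferenceOn 𝒜 f) (n : ℕ) : ConstOnAtoms (𝒜 n) (f n) := by
  intro A hA x hx y hy
  obtain ⟨c, hc⟩ := hf.constant_on n A hA
  rw [hc x hx, hc y hy]

/-- The indicator of an atom of 𝒜_k is constant on the atoms of every finer partition, hence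
orthogonal to all later differences. -/
lemma setIntegral_eq_zero (hf : IsMartingaleDifferenceOn 𝒜 f) {k j : ℕ} (hkj : k < j) {A : Set ℝ}
    (hA : A ∈ 𝒜 k) : ∫ x in A, f j x ∂unitMeasure = 0 := by
  obtain ⟨n, rfl⟩ : ∃ n, j = n + 1 := ⟨j - 1, by omega⟩
  have hP := hf.filtration.partition k
  have hind : ∀ x, A.indicator (fun _ => (1 : ℝ)) x * f (n + 1) x = A.indicator (f (n + 1)) x :=
    fun x => by by_cases hx : x ∈ A <;> simp [hx]
  have hconst : ConstOnAtoms (𝒜 k) (A.indicator fun _ => (1 : ℝ)) := fun B hB x hx y hy => by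
    by_cases hAB : A = B
    · subst hAB; simp [hx, hy]
    · have hd : ∀ z ∈ B, z ∉ A := fun z hz => Set.disjoint_right.1 (hP.disjoint hA hB hAB) hz
      simp [hd x hx, hd y hy]
  have h := (hf.filtration.partition n).integral_mul_eq_zero
    (hconst.of_le hf.filtration (Nat.lt_succ_iff.1 hkj)) (g := f (n + 1))
    (((hf.integrable _).indicator₀ (hP.nullMeasurableSet hA)).congr
      (.of_forall fun x => (hind x).symm)) fun B hB => by
        rw [(hf.filtration.partition n).restrict_eq hB, hf.integral_eq_zero n B hB]
  simpa only [hind, integral_indicator₀ (hP.nullMeasurableSet hA)] using h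

/-- The terms of a square integrable polynomial are square integrable. -/
lemma memLp_two_term (hf : IsMartingaleDifferenceOn 𝒜 f) {G : Finset ℕ} {c : ℕ → ℝ}
    (h : MemLp (fun x => ∑ j ∈ G, c j * f j x) 2 unitMeasure) {k : ℕ} (hk : k ∈ G) :
    MemLp (fun x => c k * f k x) 2 unitMeasure := by
  -- For m > 0 the truncation is the conditional expectation of the whole polynomial on 𝒜_{m-1},
  -- hence in L². A single term is the difference of two consecutive truncations.
  have hpart : ∀ m, MemLp (fun x => ∑ j ∈ G with j < m, c j * f j x) 2 unitMeasure := by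
    intro m
    cases m with
    | zero => simp
    | succ m =>
      have hP := hf.filtration.partition m
      refine hP.memLp_two_of_setIntegral_eq (fun A hA x hx y hy => ?_) h fun A hA => ?_
      · refine Finset.sum_congr rfl fun j hj => ?_
        rw [(hf.constOnAtoms j).of_le hf.filtration
          (Nat.lt_succ_iff.1 (Finset.mem_filter.1 hj).2) A hA x hx y hy]
      · have hint : ∀ j, Integrable (fun x => c j * f j x) (unitMeasure.restrict A) :=
          fun j => ((hf.integrable j).const_mul (c j)).integrableOn
        rw [integral_finsetSum _ fun j _ => hint j, integral_finsetSum _ fun j _ => hint j,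
          Finset.sum_filter]
        refine Finset.sum_congr rfl fun j _ => ?_
        split_ifs with hj
        · rfl
        · rw [integral_const_mul, hf.setIntegral_eq_zero (by omega) hA, mul_zero]
  refine ((hpart (k + 1)).sub (hpart k)).ae_eq (.of_forall fun x => ?_)
  have hfil : (G.filter fun j => j < k + 1) = insert k (G.filter fun j => j < k) := by
    ext j
    simp only [Finset.mem_filter, Finset.mem_insert]
    constructor
    · rintro ⟨h1, h2⟩
      rcases Nat.lt_succ_iff_lt_or_eq.1 h2 with h3 | h3
      · exact .inr ⟨h1, h3⟩
      · exact .inl h3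
    · rintro (rfl | ⟨h1, h2⟩)
      · exact ⟨hk, by omega⟩
      · exact ⟨h1, by omega⟩
  simp only [Pi.sub_apply, hfil]
  rw [Finset.sum_insert (by simp), add_sub_cancel_right]

end IsMartingaleDifferenceOn

/-- Square integrable non-overlapping polynomials are blocks of a square integrable martingale
difference. -/
lemma exists_isL2MartingaleDifferenceOn {f p : ℕ → ℝ → ℝ} (hf : IsMartingaleDifference f)
    (hp : IsNonOverlappingPolynomials f p) (hnorm : ∀ n, eLpNorm (p n) 2 unitMeasure = 1) :
    ∃ (𝒜 : ℕ → Set (Set ℝ)) (D : ℕ → ℝ → ℝ) (G : ℕ → Finset ℕ),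
      IsL2MartingaleDifferenceOn 𝒜 D ∧ (∀ m n, m ≠ n → Disjoint (G m) (G n)) ∧
      ∀ n, p n =ᵐ[unitMeasure] fun x => ∑ j ∈ G n, D j x := by
  classical
  obtain ⟨𝒜, hf⟩ := hf
  obtain ⟨G, c, hG, hpG⟩ := hp
  have hae : ∀ n, p n =ᵐ[unitMeasure] fun x => ∑ j ∈ G n, c j * f j x := fun n => by
    filter_upwards [ae_restrict_mem measurableSet_Ico] with x hx using hpG n x hx
  have hmem : ∀ n, MemLp (fun x => ∑ j ∈ G n, c j * f j x) 2 unitMeasure := fun n =>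
    ⟨(integrable_finsetSum _ fun j _ => (hf.integrable j).const_mul (c j)).1, by
      rw [← eLpNorm_congr_ae (hae n), hnorm]; exact ENNReal.one_lt_top⟩
  -- Outside all `G n` nothing makes `c j * f j` square integrable, so those terms are replaced by
  -- zero.
  set C : ℕ → ℝ := fun j => if ∃ n, j ∈ G n then c j else 0 with hC
  refine ⟨𝒜, fun j x => C j * f j x, G, ⟨hf.filtration, fun j => ?_, fun j A hA x hx y hy => ?_,
    fun j A hA => ?_⟩, hG, fun n => (hae n).trans (.of_forall fun x => ?_)⟩
  · by_cases hj : ∃ n, j ∈ G n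
    · simp only [hC, if_pos hj]
      exact hf.memLp_two_term (hmem hj.choose) hj.choose_spec
    · simp [hC, hj]
  · simp only [hf.constOnAtoms j A hA x hx y hy]
  · rw [integral_const_mul, hf.setIntegral_eq_zero j.lt_succ_self hA, mul_zero]
  · refine Finset.sum_congr rfl fun j hj => ?_
    have hCj : C j = c j := if_pos ⟨n, hj⟩
    simp only [hCj]

lemma integral_mul_self_eq_one {g : ℝ → ℝ} (hg : MemLp g 2 unitMeasure)
    (h : eLpNorm g 2 unitMeasure = 1) : ∫ x, g x * g x ∂unitMeasure = 1 := by
  rw [hg.eLpNorm_eq_integral_rpow_norm two_ne_zero ENNReal.ofNat_ne_top, ENNReal.ofReal_eq_one] at h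
  have h1 : ∀ x, ‖g x‖ ^ ENNReal.toReal 2 = g x * g x := fun x => by
    rw [ENNReal.toReal_ofNat, Real.rpow_ofNat, Real.norm_eq_abs, sq_abs, sq]
  simp only [h1] at h
  rwa [ENNReal.toReal_ofNat, ← one_div, ← Real.sqrt_eq_rpow, Real.sqrt_eq_one] at h

namespace IsL2MartingaleDifferenceOn

variable {𝒜 : ℕ → Set (Set ℝ)} {D : ℕ → ℝ → ℝ}

lemma integral_sum_mul_sum (hD : IsL2MartingaleDifferenceOn 𝒜 D) (s t : Finset ℕ) :
    ∫ x, (∑ i ∈ s, D i x) * ∑ j ∈ t, D j x ∂unitMeasure =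
      ∑ i ∈ s ∩ t, ∫ x, D i x ^ 2 ∂unitMeasure := by
  have hint : ∀ i j, Integrable (fun x => D i x * D j x) unitMeasure :=
    fun i j => (hD.memLp i).integrable_mul (hD.memLp j)
  simp only [Finset.sum_mul_sum]
  rw [integral_finsetSum _ fun i _ => integrable_finsetSum _ fun j _ => hint i j,
    ← Finset.filter_mem_eq_inter, Finset.sum_filter]
  refine Finset.sum_congr rfl fun i _ => ?_
  rw [integral_finsetSum _ fun j _ => hint i j]
  have hij : ∀ j, ∫ x, D i x * D j x ∂unitMeasure =
      if i = j then ∫ x, D i x ^ 2 ∂unitMeasure else 0 := fun j => by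
    split_ifs with h
    · subst h; simp only [sq]
    · obtain h | h := lt_or_gt_of_ne h
      · exact hD.integral_mul_eq_zero_of_lt h
      · simpa only [mul_comm] using hD.integral_mul_eq_zero_of_lt h
  simp only [hij, Finset.sum_ite_eq]

lemma isOrthonormalSystem (hD : IsL2MartingaleDifferenceOn 𝒜 D) {G : ℕ → Finset ℕ}
    (hG : ∀ m n, m ≠ n → Disjoint (G m) (G n)) {p : ℕ → ℝ → ℝ}
    (hp : ∀ n, p n =ᵐ[unitMeasure] fun x => ∑ j ∈ G n, D j x)
    (hnorm : ∀ n, eLpNorm (p n) 2 unitMeasure = 1) : IsOrthonormalSystem p := by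
  have hmem : ∀ n, MemLp (p n) 2 unitMeasure := fun n =>
    (memLp_finsetSum _ fun j _ => hD.memLp j).ae_eq (hp n).symm
  refine ⟨hmem, fun n => integral_mul_self_eq_one (hmem n) (hnorm n), fun m n hmn => ?_⟩
  refine (integral_congr_ae ((hp m).mul (hp n))).trans ((hD.integral_sum_mul_sum _ _).trans ?_)
  rw [Finset.disjoint_iff_inter_eq_empty.1 (hG m n hmn), Finset.sum_empty]

end IsL2MartingaleDifferenceOn


/-! ### Doubly exponential blocks, Borel–Cantelli and convergence -/

lemma ae_summable_of_summable_integral {g : ℕ → ℝ → ℝ} (hg : ∀ n, Integrable (g n) unitMeasure)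
    (hg0 : ∀ n x, 0 ≤ g n x) (hsum : Summable fun n => ∫ x, g n x ∂unitMeasure) :
    ∀ᵐ x ∂unitMeasure, Summable fun n => g n x := by
  have h := summable_norm_of_tsum_eLpNorm_ne_top (μ := unitMeasure) le_rfl
    (fun n => (hg n).1) (by
      have : ∀ n, eLpNorm (g n) 1 unitMeasure = ENNReal.ofReal (∫ x, g n x ∂unitMeasure) :=
        fun n => by
          rw [eLpNorm_one_eq_lintegral_enorm, ← ofReal_integral_norm_eq_lintegral_enorm (hg n)]
          simp only [Real.norm_of_nonneg (hg0 n _)]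
      simpa only [this] using hsum.tsum_ofReal_ne_top)
  filter_upwards [h] with x hx using hx.of_norm

/-- The dyadic logarithm of the dyadic logarithm, rounded down. -/
def logLog (n : ℕ) : ℕ := Nat.log 2 (Nat.log 2 n)

/-- The indices `n` with `logLog n = k`. -/
def logLogBlock (k : ℕ) : Finset ℕ := {n ∈ Finset.range (2 ^ 2 ^ (k + 1)) | logLog n = k}

lemma mem_logLogBlock (k n : ℕ) : n ∈ logLogBlock k ↔ logLog n = k := by
  simp only [logLogBlock, Finset.mem_filter, Finset.mem_range, and_iff_right_iff_imp]
  rintro rfl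
  exact Nat.lt_pow_of_log_lt one_lt_two (Nat.lt_pow_succ_log_self one_lt_two _)

lemma card_logLogBlock_le (k : ℕ) : (logLogBlock k).card ≤ 2 ^ 2 ^ (k + 1) :=
  (Finset.card_filter_le _ _).trans (Finset.card_range _).le

lemma two_pow_two_pow_logLog_le {n : ℕ} (hn : 2 ≤ n) : 2 ^ 2 ^ logLog n ≤ n := by
  have h : 1 ≤ Nat.log 2 n := Nat.log_pos one_lt_two hn
  exact (Nat.pow_le_pow_right two_pos (Nat.pow_log_le_self 2 (by omega))).trans
    (Nat.pow_log_le_self 2 (by omega))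

/-- The union bound over a block: its size costs e^{2·2^k}, so the exponent 3·2^k leaves e^{-2^k},
more than enough for Borel–Cantelli. -/
lemma card_logLogBlock_mul_exp_le (k : ℕ) :
    ((logLogBlock k).card : ℝ) * (4 * Real.exp (-(3 * 2 ^ k))) ≤ 4 * Real.exp (-k) := by
  have h1 : ((logLogBlock k).card : ℝ) ≤ Real.exp (2 * 2 ^ k) := by
    calc ((logLogBlock k).card : ℝ) ≤ 2 ^ 2 ^ (k + 1) := by exact_mod_cast card_logLogBlock_le k
      _ ≤ Real.exp 1 ^ 2 ^ (k + 1) :=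
        pow_le_pow_left₀ zero_le_two (by linarith [Real.add_one_le_exp (1 : ℝ)]) _
      _ = Real.exp (2 * 2 ^ k) := by rw [← Real.exp_nat_mul]; push_cast; ring_nf
  have h2 : (k : ℝ) ≤ 2 ^ k := by exact_mod_cast Nat.lt_two_pow_self.le
  calc ((logLogBlock k).card : ℝ) * (4 * Real.exp (-(3 * 2 ^ k)))
      ≤ Real.exp (2 * 2 ^ k) * (4 * Real.exp (-(3 * 2 ^ k))) := by gcongr
    _ = 4 * Real.exp (-(2 ^ k)) := by
      rw [mul_left_comm, ← Real.exp_add]; ring_nf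
    _ ≤ 4 * Real.exp (-k) := by gcongr

namespace IsL2MartingaleDifferenceOn

variable {𝒜 : ℕ → Set (Set ℝ)} {D : ℕ → ℝ → ℝ}

lemma ae_summable_bracket (hD : IsL2MartingaleDifferenceOn 𝒜 D) {G : ℕ → Finset ℕ}
    (hG1 : ∀ n, ∑ j ∈ G n, ∫ x, D j x ^ 2 ∂unitMeasure = 1) {w : ℕ → ℝ} (hw0 : ∀ n, 0 ≤ w n)
    (hw : Summable w) :
    ∀ᵐ x ∂unitMeasure, Summable fun n => w n * ∑ j ∈ G n, bracket 𝒜 D j x := by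
  refine ae_summable_of_summable_integral
    (fun n => (integrable_finsetSum _ fun j _ => hD.integrable_bracket j).const_mul _)
    (fun n x => mul_nonneg (hw0 n) (Finset.sum_nonneg fun j _ => bracket_nonneg 𝒜 D j x)) ?_
  refine (hw.mul_right 3).of_nonneg_of_le (fun n => integral_nonneg fun x =>
    mul_nonneg (hw0 n) (Finset.sum_nonneg fun j _ => bracket_nonneg 𝒜 D j x)) fun n => ?_
  rw [integral_const_mul, integral_finsetSum _ fun j _ => hD.integrable_bracket j]
  refine mul_le_mul_of_nonneg_left ?_ (hw0 n)
  calc ∑ j ∈ G n, ∫ x, bracket 𝒜 D j x ∂unitMeasure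
      ≤ ∑ j ∈ G n, 3 * ∫ x, D j x ^ 2 ∂unitMeasure :=
        Finset.sum_le_sum fun j _ => hD.integral_bracket_le j
    _ = 3 := by rw [← Finset.mul_sum, hG1, mul_one]

/-- The Chernoff bound for linear combinations of non-overlapping sums. -/
lemma measureReal_sum_le_exp_neg (hD : IsL2MartingaleDifferenceOn 𝒜 D) {G : ℕ → Finset ℕ}
    (hG : ∀ m n, m ≠ n → Disjoint (G m) (G n)) (a : ℕ → ℝ) (E : Finset ℕ) {t : ℝ} (ht : 0 < t)
    (u : ℝ) :
    unitMeasure.real {x | u / t + t * ∑ n ∈ E, a n ^ 2 * ∑ j ∈ G n, bracket 𝒜 D j x ≤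
      |∑ n ∈ E, a n * ∑ j ∈ G n, D j x|} ≤ 4 * Real.exp (-u) := by
  classical
  -- The coefficient of D_j is a_n for j in G_n; disjointness makes the choice of n immaterial.
  set r : ℕ → ℝ := fun j => if h : ∃ n, j ∈ G n then a h.choose else 0 with hr
  have hra : ∀ n, ∀ j ∈ G n, r j = a n := fun n j hj => by
    have h : ∃ n, j ∈ G n := ⟨n, hj⟩
    have hn : h.choose = n := by
      by_contra hne
      exact Finset.disjoint_left.1 (hG _ _ hne) h.choose_spec hj
    simp only [hr, dif_pos h, hn]
  have hdisj : (E : Set ℕ).PairwiseDisjoint G := fun m _ n _ hmn => hG m n hmn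
  have h := hD.measureReal_le_exp_neg r (E.biUnion G) ht u
  simp only [Finset.sum_biUnion hdisj] at h
  convert h using 9 with x
  · rw [Finset.mul_sum]
    exact Finset.sum_congr rfl fun j hj => by rw [hra _ j hj]
  · rw [Finset.mul_sum]
    exact Finset.sum_congr rfl fun j hj => by rw [hra _ j hj]

/-- The bound for the partial sums of a rearrangement restricted to the blocks. -/
lemma ae_eventually_block_bound (hD : IsL2MartingaleDifferenceOn 𝒜 D) {G : ℕ → Finset ℕ}
    (hG : ∀ m n, m ≠ n → Disjoint (G m) (G n)) (a : ℕ → ℝ) {t : ℕ → ℝ} (ht : ∀ k, 0 < t k)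
    (σ : Equiv.Perm ℕ) :
    ∀ᵐ x ∂unitMeasure, ∀ᶠ k in atTop, ∀ M,
      |∑ n ∈ logLogBlock k with σ.symm n < M, a n * ∑ j ∈ G n, D j x| ≤
        3 * 2 ^ k / t k +
          t k * ∑ n ∈ logLogBlock k, a n ^ 2 * ∑ j ∈ G n, bracket 𝒜 D j x := by
  -- A nonempty initial segment of the block in the order of σ is determined by its last element m.
  -- The infinitely many cutoffs M thus reduce to at most one event per element of the block.
  set E : ℕ → ℕ → Finset ℕ := fun k m => {n ∈ logLogBlock k | σ.symm n ≤ σ.symm m} with hE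
  set bad : ℕ → Set ℝ := fun k => ⋃ m ∈ logLogBlock k,
    {x | 3 * 2 ^ k / t k + t k * ∑ n ∈ E k m, a n ^ 2 * ∑ j ∈ G n, bracket 𝒜 D j x ≤
      |∑ n ∈ E k m, a n * ∑ j ∈ G n, D j x|} with hbad
  have hbad_le : ∀ k, unitMeasure (bad k) ≤ ENNReal.ofReal (4 * Real.exp (-k)) := fun k => by
    rw [← ofReal_measureReal (measure_ne_top _ _)]
    refine ENNReal.ofReal_le_ofReal ((measureReal_biUnion_finset_le _ _).trans ?_)
    refine (Finset.sum_le_card_nsmul _ _ _ fun m _ =>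
      hD.measureReal_sum_le_exp_neg hG a (E k m) (ht k) (3 * 2 ^ k)).trans ?_
    rw [nsmul_eq_mul]
    exact card_logLogBlock_mul_exp_le k
  have hsum : ∑' k, unitMeasure (bad k) ≠ ⊤ :=
    ne_top_of_le_ne_top (Real.summable_exp_neg_nat.mul_left 4).tsum_ofReal_ne_top
      (ENNReal.tsum_le_tsum hbad_le)
  filter_upwards [ae_eventually_notMem hsum] with x hx
  filter_upwards [hx] with k hk M
  have hQ : ∀ n, 0 ≤ a n ^ 2 * ∑ j ∈ G n, bracket 𝒜 D j x := fun n =>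
    mul_nonneg (sq_nonneg _) (Finset.sum_nonneg fun j _ => bracket_nonneg 𝒜 D j x)
  obtain h | h := Finset.eq_empty_or_nonempty {n ∈ logLogBlock k | σ.symm n < M}
  · have := ht k
    rw [h, Finset.sum_empty, abs_zero]
    exact add_nonneg (by positivity) (mul_nonneg this.le (Finset.sum_nonneg fun n _ => hQ n))
  · obtain ⟨m, hm, hmax⟩ := Finset.exists_max_image _ σ.symm h
    obtain ⟨hmk, hmM⟩ := Finset.mem_filter.1 hm
    have hEm : ({n ∈ logLogBlock k | σ.symm n < M} : Finset ℕ) = E k m := by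
      ext n
      simp only [hE, Finset.mem_filter, and_congr_right_iff]
      exact fun hn => ⟨fun hnM => hmax n (Finset.mem_filter.2 ⟨hn, hnM⟩), fun hnm => hnm.trans_lt hmM⟩
    have hkm : ¬ (3 * 2 ^ k / t k + t k * ∑ n ∈ E k m, a n ^ 2 * ∑ j ∈ G n, bracket 𝒜 D j x ≤
        |∑ n ∈ E k m, a n * ∑ j ∈ G n, D j x|) := fun hle =>
      hk (Set.mem_biUnion hmk hle)
    rw [hEm]
    refine (not_le.1 hkm).le.trans ?_
    gcongr
    · exact (ht k).le
    · exact fun n _ _ => hQ n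
    · exact Finset.filter_subset _ _

/-- The choice t_k = ω(2^{2^k}) makes both terms of the block bound summable: the deviation by
condensation, the bracket term because t_k ≤ ω(n) on the block, apart from the indices 0 and 1. -/
lemma aeUnconditionallyConvergent (hD : IsL2MartingaleDifferenceOn 𝒜 D) {G : ℕ → Finset ℕ}
    (hG : ∀ m n, m ≠ n → Disjoint (G m) (G n))
    (hG1 : ∀ n, ∑ j ∈ G n, ∫ x, D j x ^ 2 ∂unitMeasure = 1)
    {ω : ℕ → ℝ} (hpos : ∀ n, 0 < ω n) (hmono : Monotone ω)
    (hsum : Summable fun n : ℕ => 1 / (((n : ℝ) + 1) * ω n))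
    {a : ℕ → ℝ} (ha : Summable fun n => a n ^ 2 * ω n) :
    AEUnconditionallyConvergent fun n x => a n * ∑ j ∈ G n, D j x := by
  intro σ
  have hw0 : ∀ n, 0 ≤ a n ^ 2 * ω (2 ^ 2 ^ logLog n) := fun n =>
    mul_nonneg (sq_nonneg _) (hpos _).le
  have hw : Summable fun n => a n ^ 2 * ω (2 ^ 2 ^ logLog n) := by
    refine ha.of_norm_bounded_eventually_nat ?_
    filter_upwards [eventually_ge_atTop 2] with n hn
    rw [Real.norm_of_nonneg (hw0 n)]
    exact mul_le_mul_of_nonneg_left (hmono (two_pow_two_pow_logLog_le hn)) (sq_nonneg _)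
  filter_upwards [hD.ae_summable_bracket hG1 hw0 hw,
    hD.ae_eventually_block_bound hG a (t := fun k => ω (2 ^ 2 ^ k)) (fun k => hpos _) σ]
    with x hx hbd
  refine exists_tendsto_sum_of_block_bound logLog logLogBlock mem_logLogBlock σ
    (fun n => a n * ∑ j ∈ G n, D j x) (Summable.add ?_ ?_) hbd
  · simpa only [mul_div_assoc] using (summable_two_pow_div_weight hpos hmono hsum).mul_left 3
  · refine (Summable.sum_block mem_logLogBlock (fun n => mul_nonneg (hw0 n)
      (Finset.sum_nonneg fun j _ => bracket_nonneg 𝒜 D j x)) hx).congr fun k => ?_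
    rw [Finset.mul_sum]
    refine Finset.sum_congr rfl fun n hn => ?_
    rw [(mem_logLogBlock k n).1 hn]
    ring

end IsL2MartingaleDifferenceOn

lemma AEUnconditionallyConvergent.congr {g h : ℕ → ℝ → ℝ} (hg : AEUnconditionallyConvergent g)
    (hgh : ∀ n, g n =ᵐ[unitMeasure] h n) : AEUnconditionallyConvergent h := fun σ => by
  filter_upwards [hg σ, ae_all_iff.2 hgh] with x hx hxe
  simpa only [hxe] using hx

end WeylMultipliers

theorem corollary3
    (f : ℕ → ℝ → ℝ) (hf : WeylMultipliers.IsMartingaleDifference f)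
    (p : ℕ → ℝ → ℝ) (hp : WeylMultipliers.IsNonOverlappingPolynomials f p)
    (hnorm : ∀ n, eLpNorm (p n) 2 WeylMultipliers.unitMeasure = 1)
    (ω : ℕ → ℝ) (hpos : ∀ n, 0 < ω n) (hmono : Monotone ω)
    (hlog : MonotoneOn (fun n : ℕ => ω n / Real.logb 2 ((n : ℝ) + 1)) (Set.Ici 1))
    (hsum : Summable (fun n : ℕ => 1 / (((n : ℝ) + 1) * ω n))) :
    WeylMultipliers.IsUCMultiplier ω p := by
  obtain ⟨𝒜, D, G, hD, hG, hpD⟩ := WeylMultipliers.exists_isL2MartingaleDifferenceOn hf hp hnorm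
  have hon := hD.isOrthonormalSystem hG hpD hnorm
  refine ⟨hon, hpos, hmono, WeylMultipliers.tendsto_weight_atTop hpos hmono hsum, fun a ha => ?_⟩
  have hG1 : ∀ n, ∑ j ∈ G n, ∫ x, D j x ^ 2 ∂WeylMultipliers.unitMeasure = 1 := fun n => by
    have h := (integral_congr_ae ((hpD n).mul (hpD n))).symm.trans (hon.norm_eq_one n)
    have h2 := (hD.integral_sum_mul_sum (G n) (G n)).symm.trans h
    rwa [Finset.inter_self] at h2
  refine (hD.aeUnconditionallyConvergent hG hG1 hpos hmono hsum ha).congr fun n => ?_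
  filter_upwards [hpD n] with x hx
  rw [hx]
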